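/- Let $\mathbb F$ be a division ring, $\sigma:\mathbb F\to\mathbb F$ a ring endomorphism and $\delta:\mathbb F\to\mathbb F$ a $\sigma$-derivation, i.e. an additive map with $\delta(ab)=\sigma(a)\delta(b)+\delta(a)b$. Let $\mathcal R=\mathbb F[x;\sigma,\delta]$ be the Ore extension: polynomials $\sum a_ix^i$ with the usual sum and the product determined by $xa=\sigma(a)x+\delta(a)$. For $d,s\ge 0$ let $\mathcal C_{d,s}(a)$ be the sum of all compositions of $d$ copies of $\delta$ and $s$ copies of $\sigma$, evaluated at $a$ (so $\mathcal C_{0,0}(a)=a$). For $f=\sum_{j\le m}a_jx^j$ and $g=\sum_{j\le n}b_jx^j$ in $\mathcal R$ of degrees $m$ and $n$, the right $(\sigma,\delta)$-Sylvester matrix $S=\mathrm{Sylv}^{\sigma,\delta}_{\mathbb F}(f,g)$ is the $(m+n)\times(m+n)$ matrix whose first $n$ rows are $\big(\sum_{0\le l\le \min(p,q)}\mathcal C_{p-l,l}(a_{q-l})\big)_{0\le q<m+n}$ for $0\le p<n$, and whose last $m$ rows are the same with $b$ in place of $a$, for $0\le p<m$ (with $a_j=0$ for $j>m$ and $b_j=0$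 for $j>n$). The right $(\sigma,\delta)$-resultant $R^{\sigma,\delta}_{\mathbb F}(f,g)$ is the Dieudonné determinant of $S$, an element of $\{0\}\cup\mathbb F^*/[\mathbb F^*,\mathbb F^*]$. We say that $c\in\mathbb F$ is a value modulo $[\mathbb F^*,\mathbb F^*]$ of a polynomial $P=\sum_\alpha n_\alpha X^\alpha\in\mathbb Z[X_{ij}:1\le i,j\le m+n]$ at the entries of $S$ if $c=\sum_\alpha n_\alpha w_\alpha$ for some $w_\alpha\in\mathbb F$ such that the class of $w_\alpha$ in $\{0\}\cup\mathbb F^*/[\mathbb F^*,\mathbb F^*]$ is the product of the classes of the entries of $S$ prescribed by the monomial $X^\alpha$ (that is, products are taken modulo commutators, and sums are sums of cosets). **Proposition.** Let $m,n\ge 1$. There are polynomials $P_k,Q_k\in\mathbb Z[X_{ij}:1\le i,j\le m+n]$ ($k\ge0$), depending only on $m$ and $n$, such that for all $\mathbb F,\sigma,\delta$ as above and all $f,g\in\mathcal R$ of degrees $m$ and $n$ there are $A,B\in\mathcal R$ with $$Af+Bg=R^{\sigma,\delta}_{\mathbb F}(f,g),$$ meaning that $Af+Bg$ is a constant $r\in\mathbb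 F$ whose class in $\{0\}\cup\mathbb F^*/[\mathbb F^*,\mathbb F^*]$ is $R^{\sigma,\delta}_{\mathbb F}(f,g)$, and such that, for every $k$, the coefficients of $x^k$ in $A$ and in $B$ are values modulo $[\mathbb F^*,\mathbb F^*]$ of $P_k$ and $Q_k$, respectively, at the entries of $\mathrm{Sylv}^{\sigma,\delta}_{\mathbb F}(f,g)$. -/

import Mathlib

universe u

/-- A `σ`-derivation of a ring `F`: an additive map `δ` with `δ (a b) = σ a * δ b + δ a * b`. -/
structure SkewDerivation {F : Type u} [Ring F] (σ : F →+* F) extends F →+ F where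
  leibniz' : ∀ a b : F, toFun (a * b) = σ a * toFun b + toFun a * b

/-- The Ore extension `F[x; σ, δ]`: the polynomials `∑ aᵢ xⁱ` with coefficients on the left, with
the usual sum, and the product determined by `x a = σ(a) x + δ(a)` (see the ring structure
below). -/
def OreExt {F : Type u} [Ring F] (σ : F →+* F) (_δ : SkewDerivation σ) : Type u := ℕ →₀ F

namespace OreExt

noncomputable section

variable {F : Type u} [Ring F] {σ : F →+* F} {δ : SkewDerivation σ}

instance : AddCommGroup (OreExt σ δ) := inferInstanceAs (AddCommGroup (ℕ →₀ F))

instance : Module F (OreExt σ δ) := inferInstanceAs (Module F (ℕ →₀ F))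

/-- The coefficient of `xⁱ`. -/
def coeff (f : OreExt σ δ) (i : ℕ) : F := (show ℕ →₀ F from f) i

/-- The degree (with value `0` for the zero polynomial). -/
def natDegree (f : OreExt σ δ) : ℕ := (show ℕ →₀ F from f).support.sup id

/-- The monomial `a xⁱ`, additively in `a`. -/
def monomial (i : ℕ) : F →+ OreExt σ δ :=
  show F →+ (ℕ →₀ F) from Finsupp.singleAddHom i

/-- The constant polynomial `a`. -/
def C (a : F) : OreExt σ δ := monomial 0 a

/-- The variable `x`. -/
def X : OreExt σ δ := monomial 1 1

/-- Extending additive maps on coefficients to an additive map on polynomials. -/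
def lift {M : Type u} [AddCommGroup M] (φ : ℕ → F →+ M) : OreExt σ δ →+ M :=
  show (ℕ →₀ F) →+ M from Finsupp.liftAddHom φ

theorem lift_monomial {M : Type u} [AddCommGroup M] (φ : ℕ → F →+ M) (i : ℕ) (a : F) :
    lift (σ := σ) (δ := δ) φ (monomial i a) = φ i a :=
  Finsupp.liftAddHom_apply_single φ i a

theorem hom_ext {M : Type u} [AddCommGroup M] {φ ψ : OreExt σ δ →+ M}
    (h : ∀ i a, φ (monomial i a) = ψ (monomial i a)) : φ = ψ :=
  Finsupp.addHom_ext (M := F) (N := M) h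

theorem smul_monomial (i : ℕ) (a b : F) :
    a • (monomial i b : OreExt σ δ) = monomial i (a * b) :=
  Finsupp.smul_single a i b

/-- Left multiplication by `x`: it sends `∑ aᵢ xⁱ` to `∑ (σ(aᵢ) xⁱ⁺¹ + δ(aᵢ) xⁱ)`. -/
def xMul : AddMonoid.End (OreExt σ δ) :=
  lift fun i => (monomial (i + 1)).comp σ.toAddMonoidHom + (monomial i).comp δ.toAddMonoidHom

theorem xMul_monomial (i : ℕ) (a : F) :
    xMul (monomial i a : OreExt σ δ) = monomial (i + 1) (σ a) + monomial i (δ.toFun a) :=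
  lift_monomial _ i a

/-- Multiplication by a coefficient on the left, as a ring homomorphism to additive
endomorphisms. -/
abbrev cMul : F →+* AddMonoid.End (OreExt σ δ) := Module.toAddMonoidEnd F (OreExt σ δ)

theorem xMul_smul (a : F) (f : OreExt σ δ) :
    xMul (a • f) = σ a • xMul f + δ.toFun a • f := by
  have : (xMul : AddMonoid.End (OreExt σ δ)) * cMul a
      = cMul (σ a) * xMul + cMul (δ.toFun a) := by
    refine hom_ext fun i b => ?_
    change xMul (a • monomial i b) = σ a • xMul (monomial i b) + δ.toFun a • monomial i b
    rw [smul_monomial, xMul_monomial, xMul_monomial, smul_add, smul_monomial, smul_monomial,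
      smul_monomial, map_mul, δ.leibniz', map_add]
    abel
  exact DFunLike.congr_fun this f

/-- Left multiplication by `f = ∑ aᵢ xⁱ`: the operator `∑ aᵢ (left multiplication by x)ⁱ`. -/
def leftMul : OreExt σ δ →+ AddMonoid.End (OreExt σ δ) :=
  lift fun i => (AddMonoidHom.mulRight (xMul ^ i)).comp cMul.toAddMonoidHom

theorem leftMul_monomial (i : ℕ) (a : F) :
    leftMul (monomial i a : OreExt σ δ) = cMul a * xMul ^ i :=
  lift_monomial _ i a

theorem leftMul_smul (a : F) (f : OreExt σ δ) : leftMul (a • f) = cMul a * leftMul f := by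
  have : leftMul.comp (cMul a) = (AddMonoidHom.mulLeft (cMul a)).comp
      (leftMul (σ := σ) (δ := δ)) := by
    refine hom_ext fun i b => ?_
    change leftMul (a • monomial i b) = cMul a * leftMul (monomial i b)
    rw [smul_monomial, leftMul_monomial, leftMul_monomial, map_mul, mul_assoc]
  exact DFunLike.congr_fun this f

theorem leftMul_xMul (f : OreExt σ δ) : leftMul (xMul f) = xMul * leftMul f := by
  have : leftMul.comp xMul = (AddMonoidHom.mulLeft xMul).comp (leftMul (σ := σ) (δ := δ)) := by
    refine hom_ext fun i b => ?_
    change leftMul (xMul (monomial i b)) = xMul * leftMul (monomial i b)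
    rw [xMul_monomial, map_add, leftMul_monomial, leftMul_monomial, leftMul_monomial]
    ext g : 1
    change σ b • (xMul ^ (i + 1)) g + δ.toFun b • (xMul ^ i) g = xMul (b • (xMul ^ i) g)
    rw [xMul_smul, pow_succ']
    rfl
  exact DFunLike.congr_fun this f

theorem leftMul_xMul_pow (i : ℕ) (f : OreExt σ δ) :
    leftMul ((xMul ^ i) f) = xMul ^ i * leftMul f := by
  induction i with
  | zero => rfl
  | succ i ih =>
    rw [pow_succ', mul_assoc, ← ih, ← leftMul_xMul]
    rfl

theorem leftMul_leftMul (f g : OreExt σ δ) : leftMul (leftMul f g) = leftMul f * leftMul g := by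
  have : leftMul.comp (leftMul.flip g)
      = (AddMonoidHom.mulRight (leftMul g)).comp (leftMul (σ := σ) (δ := δ)) := by
    refine hom_ext fun i a => ?_
    change leftMul (leftMul (monomial i a) g) = leftMul (monomial i a) * leftMul g
    rw [leftMul_monomial, mul_assoc, ← leftMul_xMul_pow, ← leftMul_smul]
    rfl
  exact DFunLike.congr_fun this f

theorem xMul_pow_one (i : ℕ) :
    (xMul ^ i) (monomial 0 1 : OreExt σ δ) = monomial i 1 := by
  have h1 : δ.toFun 1 = 0 := by
    have := δ.leibniz' 1 1
    simpa using this
  induction i with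
  | zero => rfl
  | succ i ih =>
    rw [pow_succ']
    change xMul ((xMul ^ i) (monomial 0 1)) = _
    rw [ih, xMul_monomial, h1, map_one, map_zero, add_zero]

instance : Mul (OreExt σ δ) := ⟨fun f g => leftMul f g⟩

instance : One (OreExt σ δ) := ⟨monomial 0 1⟩

theorem mul_def (f g : OreExt σ δ) : f * g = leftMul f g := rfl

/-- The ring structure of the Ore extension. -/
instance : Ring (OreExt σ δ) where
  left_distrib f g h := map_add (leftMul f) g h
  right_distrib f g h := by simp only [mul_def, map_add]; rfl
  zero_mul f := by simp only [mul_def, map_zero]; rfl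
  mul_zero f := map_zero (leftMul f)
  mul_assoc f g h := by simp only [mul_def, leftMul_leftMul]; rfl
  one_mul f := by
    change leftMul (monomial 0 1) f = f
    rw [leftMul_monomial, map_one]
    rfl
  mul_one f := by
    have : leftMul.flip (monomial 0 1 : OreExt σ δ) = AddMonoidHom.id (OreExt σ δ) := by
      refine hom_ext fun i a => ?_
      change leftMul (monomial i a) (monomial 0 1) = monomial i a
      rw [leftMul_monomial]
      change a • (xMul ^ i) (monomial 0 1) = monomial i a
      rw [xMul_pow_one, smul_monomial, mul_one]
    exact DFunLike.congr_fun this f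
  neg_add_cancel f := neg_add_cancel f
  zsmul := fun k f => k • f
  zsmul_zero' := fun f => zero_zsmul f
  zsmul_succ' := fun k f => SubNegMonoid.zsmul_succ' k f
  zsmul_neg' := fun k f => SubNegMonoid.zsmul_neg' k f
  nsmul := fun k f => k • f
  nsmul_zero := fun f => zero_nsmul f
  nsmul_succ := fun k f => succ_nsmul f k
  sub_eq_add_neg f g := sub_eq_add_neg f g

/-- The defining commutation rule `x a = σ(a) x + δ(a)`. -/
theorem X_mul_C (a : F) : (X * C a : OreExt σ δ) = C (σ a) * X + C (δ.toFun a) := by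
  simp only [mul_def, X, C, leftMul_monomial, map_one, one_mul, pow_one, pow_zero, mul_one,
    xMul_monomial, zero_add]
  congr 1
  change monomial 1 (σ a) = σ a • (monomial 1 1 : OreExt σ δ)
  rw [smul_monomial, mul_one]

end

end OreExt

/-- `𝒞_{d,s}(a)`: the sum of all compositions of `d` copies of `δ` and `s` copies of `σ`, evaluated
at `a`. The recursion splits the compositions by their outermost map. -/
def skewComp {F : Type u} [Ring F] (σ : F →+* F) (δ : SkewDerivation σ) : ℕ → ℕ → F → F
  | 0, 0, a => a
  | d + 1, 0, a => δ.toFun (skewComp σ δ d 0 a)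
  | 0, s + 1, a => σ (skewComp σ δ 0 s a)
  | d + 1, s + 1, a =>
      δ.toFun (skewComp σ δ d (s + 1) a) + σ (skewComp σ δ (d + 1) s a)

/-- The entry `∑_{l ≤ p, l ≤ q} 𝒞_{p-l,l}(a_{q-l})` of the Sylvester matrix coming from the
polynomial `f = ∑ aⱼ xʲ`; it is the coefficient of `x^q` in `x^p f`. Here `a_j = 0` for `j`
larger than the degree of `f`. -/
def sylvesterEntry {F : Type u} [Ring F] {σ : F →+* F} {δ : SkewDerivation σ}
    (f : OreExt σ δ) (p q : ℕ) : F :=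
  ∑ l ∈ (Finset.range (p + 1)).filter (fun l => l ≤ q), skewComp σ δ (p - l) l (f.coeff (q - l))

/-- The right `(σ, δ)`-Sylvester matrix of `f` and `g`, where `m` and `n` are the degrees of `f`
and `g`: the first `n` rows come from `f`, the last `m` rows from `g`. -/
def sylvesterMatrix {F : Type u} [Ring F] {σ : F →+* F} {δ : SkewDerivation σ}
    (m n : ℕ) (f g : OreExt σ δ) : Matrix (Fin (n + m)) (Fin (n + m)) F :=
  fun i j => if (i : ℕ) < n then sylvesterEntry f i j else sylvesterEntry g (i - n) j

noncomputable section

/-- The class of an element of a division ring in `{0} ∪ F^* / [F^*, F^*]`. -/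
def modComm {F : Type u} [DivisionRing F] (a : F) : WithZero (Abelianization Fˣ) :=
  open Classical in
  if h : a = 0 then 0 else ((Abelianization.of (Units.mk0 a h) : Abelianization Fˣ) : WithZero _)

/-- The Dieudonné determinant, with values in `{0} ∪ F^* / [F^*, F^*]`, computed by elimination:
if the first column vanishes, it is `0`; otherwise let `i` be the first row with a nonzero entry
`A i 0`, subtract left multiples of row `i` from the other rows to clear the first column, and
multiply the class of `(-1)^i * A i 0` with the determinant of the matrix that remains when row `i`
and the first column are removed. -/
def dieudonneDet {F : Type u} [DivisionRing F] :
    {N : ℕ} → Matrix (Fin N) (Fin N) F → WithZero (Abelianization Fˣ)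
  | 0, _ => 1
  | N + 1, A =>
      open Classical in
      if h : ∃ i, A i 0 ≠ 0 then
        let i : Fin (N + 1) := Fin.find (fun i => A i 0 ≠ 0) h
        modComm ((-1) ^ (i : ℕ) * A i 0) *
          dieudonneDet (Matrix.of fun (k l : Fin N) =>
            A (i.succAbove k) l.succ - A (i.succAbove k) 0 * (A i 0)⁻¹ * A i l.succ)
      else 0

/-- The right `(σ, δ)`-resultant of `f` and `g`: the Dieudonné determinant of their
Sylvester matrix. -/
def skewResultant {F : Type u} [DivisionRing F] {σ : F →+* F} {δ : SkewDerivation σ}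
    (f g : OreExt σ δ) : WithZero (Abelianization Fˣ) :=
  dieudonneDet (sylvesterMatrix f.natDegree g.natDegree f g)

/-- `c` is a value, modulo `[F^*, F^*]`, of the integer polynomial `p = ∑ n_α X^α` at the elements
`v i` of `F`: one has `c = ∑ n_α w_α`, where each `w_α` represents the class in
`{0} ∪ F^* / [F^*, F^*]` of the monomial `X^α` at the `v i`. (A product of the `v i` is well defined
only in this commutative quotient, and sums are not defined there: they are sums of cosets.) -/
def IsValueModComm {F : Type u} [DivisionRing F] {ι : Type} (p : MvPolynomial ι ℤ) (v : ι → F)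
    (c : F) : Prop :=
  ∃ w : (ι →₀ ℕ) → F,
    (∀ α ∈ p.support, modComm (w α) = α.prod fun i k => modComm (v i) ^ k) ∧
      c = ∑ α ∈ p.support, ((p.coeff α : ℤ) : F) * w α

end

/-! ### Row operations and the Dieudonné determinant. -/

section DieudonneDet

variable {F : Type u} [DivisionRing F]

/-! The rows of the Sylvester matrix `S` are the coefficient sequences of the products `x^p f` and
`x^p g`, so a row vector `v` encodes a pair `A`, `B` for which `v S` lists the coefficients of `A f
+ B g`. Over a commutative field, the cofactors of the first column give `v S = (det S, 0, ..., 0)`.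
The proof finds their analogue over a division ring.

The columns of `S` other than the first form a matrix with more rows than columns, hence with a left
linear relation among its rows. Suitably scaled, this relation is a `v` for which `∑ vᵢ sᵢ`
represents the Dieudonné determinant for every choice of first column `s`
(`exists_linear_form_rowDet`). Unit vectors `s` show that each `vᵢ` represents a signed minor. This
rests on invariance under row operations, proved by induction on the size together with independence
of the pivot (`pivot_exchange`, `RowOperations.succ`).

Expanding repeatedly along first columns writes any representative of a determinant as a Leibniz sum
of representatives (`exists_leibniz_expansion`), with indices and signs that depend only on the
size. Applied to the minors, it yields the integer polynomials. -/

theorem modComm_zero : modComm (0 : F) = 0 := by simp [modComm]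

theorem modComm_of_ne {a : F} (h : a ≠ 0) :
    modComm a = ((Abelianization.of (Units.mk0 a h) : Abelianization Fˣ) : WithZero _) := by
  simp [modComm, h]

theorem modComm_eq_zero {a : F} : modComm a = 0 ↔ a = 0 := by
  refine ⟨fun h => ?_, fun h => h ▸ modComm_zero⟩
  by_contra ha
  rw [modComm_of_ne ha] at h
  exact WithZero.coe_ne_zero h

theorem modComm_one : modComm (1 : F) = 1 := by
  rw [modComm_of_ne one_ne_zero, Units.mk0_one, map_one, WithZero.coe_one]

theorem modComm_mul (a b : F) : modComm (a * b) = modComm a * modComm b := by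
  by_cases ha : a = 0
  · simp [ha, modComm_zero]
  by_cases hb : b = 0
  · simp [hb, modComm_zero]
  rw [modComm_of_ne ha, modComm_of_ne hb, modComm_of_ne (mul_ne_zero ha hb), ← WithZero.coe_mul,
    ← map_mul, Units.mk0_mul]

theorem modComm_surjective (c : WithZero (Abelianization Fˣ)) : ∃ a : F, modComm a = c := by
  induction c with
  | zero => exact ⟨0, modComm_zero⟩
  | coe c =>
    obtain ⟨v, rfl⟩ := QuotientGroup.mk_surjective c
    exact ⟨v, by rw [modComm_of_ne v.ne_zero, Units.mk0_val]; rfl⟩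

theorem modComm_inv_mul {a : F} (h : a ≠ 0) : modComm a⁻¹ * modComm a = 1 := by
  rw [← modComm_mul, inv_mul_cancel₀ h, modComm_one]

theorem modComm_neg_one_mul_self : modComm (-1 : F) * modComm (-1) = 1 := by
  rw [← modComm_mul, neg_one_mul, neg_neg, modComm_one]

/-- Turns an identity of classes into a factorization in `F`, so that sums can be formed. If `c = 0`
then `a = 0`, and any `t` of the right class serves. -/
theorem exists_mul_of_modComm_eq {a b c : F} (h : modComm a = modComm b * modComm c) :
    ∃ t, a = t * c ∧ modComm t = modComm b := by
  by_cases hc : c = 0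
  · refine ⟨b, ?_, rfl⟩
    rw [hc, mul_zero, ← modComm_eq_zero, h, hc, modComm_zero, mul_zero]
  · refine ⟨a * c⁻¹, by rw [inv_mul_cancel_right₀ hc], ?_⟩
    rw [modComm_mul, h, mul_assoc, mul_comm (modComm c), modComm_inv_mul hc, mul_one]

theorem exists_one_mul_of_modComm_eq {a b : F} (h : modComm a = modComm b) :
    ∃ t, a = t * b ∧ modComm t = 1 := by
  obtain ⟨t, ht, h1⟩ := exists_mul_of_modComm_eq (a := a) (b := 1) (c := b)
    (by rw [h, modComm_one, one_mul])
  exact ⟨t, ht, h1.trans modComm_one⟩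

/-- The Dieudonné determinant as a function of the family of rows. -/
noncomputable def rowDet {N : ℕ} (A : Fin N → Fin N → F) : WithZero (Abelianization Fˣ) :=
  dieudonneDet (Matrix.of A)

/-- The matrix left after clearing the first column with row `i`. -/
def pivotReduce {N : ℕ} (A : Fin (N + 1) → Fin (N + 1) → F) (i : Fin (N + 1)) :
    Fin N → Fin N → F :=
  fun k l => A (i.succAbove k) l.succ - A (i.succAbove k) 0 * (A i 0)⁻¹ * A i l.succ

theorem rowDet_eq_zero_of_column {N : ℕ} {A : Fin (N + 1) → Fin (N + 1) → F}
    (h : ∀ i, A i 0 = 0) : rowDet A = 0 := by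
  rw [rowDet, dieudonneDet, dif_neg]
  simpa using h

theorem exists_pivot {N : ℕ} {A : Fin (N + 1) → Fin (N + 1) → F}
    (h : ∃ i, A i 0 ≠ 0) : ∃ i, A i 0 ≠ 0 ∧
      rowDet A = modComm ((-1) ^ (i : ℕ) * A i 0) * rowDet (pivotReduce A i) := by
  classical
  refine ⟨Fin.find (fun i => A i 0 ≠ 0) h, Fin.find_spec h, ?_⟩
  rw [rowDet, dieudonneDet]
  refine (dif_pos h).trans ?_
  congr!

/-- The behaviour of the Dieudonné determinant of `N × N` matrices under row operations. -/
structure RowOperations (F : Type u) [DivisionRing F] (N : ℕ) : Prop where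
  smul : ∀ (A : Fin N → Fin N → F) (i : Fin N) (c : F),
    rowDet (Function.update A i (c • A i)) = modComm c * rowDet A
  add : ∀ (A : Fin N → Fin N → F) (i j : Fin N) (c : F), i ≠ j →
    rowDet (Function.update A i (A i + c • A j)) = rowDet A

namespace RowOperations

variable {N : ℕ}

/-- On two rows: `(a, b) → (a + b, b) → (a + b, -a) → (b, -a) → (b, a)`. Only the last step, a
scaling by `-1`, changes the determinant. -/
theorem swap (h : RowOperations F N) (A : Fin N → Fin N → F) {i j : Fin N} (hij : i ≠ j) :
    rowDet (fun k => A (Equiv.swap i j k)) = modComm (-1) * rowDet A := by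
  have h1 := h.add A i j 1 hij
  set A1 : Fin N → Fin N → F := Function.update A i (A i + (1 : F) • A j) with hA1
  have h2 := h.add A1 j i (-1) hij.symm
  set A2 : Fin N → Fin N → F := Function.update A1 j (A1 j + (-1 : F) • A1 i) with hA2
  have h3 := h.add A2 i j 1 hij
  set A3 : Fin N → Fin N → F := Function.update A2 i (A2 i + (1 : F) • A2 j) with hA3
  have h4 := h.smul A3 j (-1)
  rw [← h1, ← h2, ← h3, ← h4]
  congr 1
  funext k
  by_cases hk : k = j
  · subst hk
    simp [hA3, hA2, hA1, hij, hij.symm]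
  by_cases hk' : k = i
  · subst hk'
    simp [hA3, hA2, hA1, hij, hij.symm]
  · simp [hA3, hA2, hA1, hk, hk', Equiv.swap_apply_of_ne_of_ne hk' hk]

theorem perm (h : RowOperations F N) (τ : Equiv.Perm (Fin N)) (A : Fin N → Fin N → F) :
    rowDet (fun k => A (τ k)) = modComm (((Equiv.Perm.sign τ : ℤˣ) : ℤ) : F) *
      rowDet A := by
  induction τ using Equiv.Perm.swap_induction_on' generalizing A with
  | one => simp [modComm_one]
  | mul_swap τ i j hij ih =>
    have := h.swap (fun k => A (τ k)) hij
    simp only [Equiv.Perm.mul_apply]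
    rw [this, ih, map_mul, Equiv.Perm.sign_swap hij, ← mul_assoc, ← modComm_mul]
    simp

theorem add_smul (h : RowOperations F N) (A : Fin N → Fin N → F) (p : Fin N)
    (c : Fin N → F) (hc : c p = 0) :
    rowDet (fun k => A k + c k • A p) = rowDet A := by
  -- The rows are changed one at a time; row `p` stays fixed because `c p = 0`.
  have key : ∀ s : Finset (Fin N), p ∉ s →
      rowDet (fun k => if k ∈ s then A k + c k • A p else A k) = rowDet A := by
    intro s
    induction s using Finset.induction_on with
    | empty => simp
    | insert a s ha ih =>
      intro hp
      rw [Finset.mem_insert, not_or] at hp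
      rw [← ih hp.2, ← h.add (fun k => if k ∈ s then A k + c k • A p else A k) a p (c a)
        (Ne.symm hp.1)]
      congr 1
      funext k
      by_cases hk : k = a
      · subst hk
        simp [ha, hp.2]
      · simp [hk]
  rw [← key (Finset.univ.erase p) (by simp)]
  congr 1
  funext k
  by_cases hk : k = p
  · simp [hk, hc]
  · simp [hk]

theorem smul_add_smul (h : RowOperations F N) (A : Fin N → Fin N → F) (p : Fin N)
    (c : Fin N → F) (b : F) :
    rowDet (fun k => if k = p then b • A p else A k + c k • A p)
      = modComm b * rowDet A := by
  rw [← h.add_smul A p (Function.update c p 0) (by simp), ← h.smul _ p b]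
  congr 1
  funext k
  by_cases hk : k = p
  · subst hk
    simp
  · simp [hk]

theorem eq_zero (h : RowOperations F N) {A : Fin N → Fin N → F} {i : Fin N}
    (hi : A i = 0) : rowDet A = 0 := by
  have := h.smul A i 0
  rwa [hi, smul_zero, ← hi, Function.update_eq_self, modComm_zero, zero_mul] at this

end RowOperations

/-- Two ways of deleting one of two rows `i ≠ j` differ by a permutation of the remaining rows,
once `j` is put in the place of `i`. -/
theorem exists_perm_succAbove {N : ℕ} {i j : Fin (N + 1)} :
    ∃ τ : Equiv.Perm (Fin N), (∀ k, i.succAbove (τ k) = Equiv.swap i j (j.succAbove k)) ∧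
      Equiv.Perm.sign τ = (-1) ^ (i : ℕ) * Equiv.Perm.sign (Equiv.swap i j) * (-1) ^ (j : ℕ) := by
  -- `e` sends `0 ↦ j ↦ i ↦ 0`, so it restricts to the successors; `τ` is that restriction and has
  -- the same sign.
  set e : Equiv.Perm (Fin (N + 1)) := i.cycleRange * Equiv.swap i j * j.cycleRange⁻¹ with he
  obtain ⟨⟨q, τ⟩, hτ⟩ := Equiv.Perm.decomposeFin.symm.surjective e
  have he0 : e 0 = 0 := by
    simp [he, Equiv.Perm.mul_apply, Equiv.Perm.inv_def, Fin.cycleRange_symm_zero]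
  have hq : q = 0 := by
    rw [← he0, ← hτ, Equiv.Perm.decomposeFin_symm_apply_zero]
  subst hq
  refine ⟨τ, fun k => ?_, ?_⟩
  · have h1 : e k.succ = (τ k).succ := by
      rw [← hτ, Equiv.Perm.decomposeFin_symm_apply_succ]
      simp
    rw [← Fin.cycleRange_symm_succ, ← h1, Equiv.symm_apply_eq]
    simp [he, Equiv.Perm.mul_apply, Equiv.Perm.inv_def, Fin.cycleRange_symm_succ]
  · have h2 : Equiv.Perm.sign e = Equiv.Perm.sign τ := by
      rw [← hτ, Equiv.Perm.decomposeFin.symm_sign]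
      simp
    rw [← h2, he]
    simp [Fin.sign_cycleRange]

/-- Write `R_i` for the rows reduced by pivot `i`. Then `R_j(i) = -(A i 0 * (A j 0)⁻¹) R_i(j)`, and
`R_j(k) = R_i(k) - A k 0 * (A j 0)⁻¹ R_i(j)` for the other `k`. The two reduced matrices thus differ
by row operations and a permutation, whose sign cancels the remaining signs. -/
theorem pivot_exchange {N : ℕ} (h : RowOperations F N)
    (A : Fin (N + 1) → Fin (N + 1) → F) {i j : Fin (N + 1)} (hi : A i 0 ≠ 0)
    (hj : A j 0 ≠ 0) :
    modComm ((-1) ^ (j : ℕ) * A j 0) * rowDet (pivotReduce A j)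
      = modComm ((-1) ^ (i : ℕ) * A i 0) * rowDet (pivotReduce A i) := by
  by_cases hij : i = j
  · rw [hij]
  obtain ⟨τ, hτ, hs⟩ := exists_perm_succAbove (i := i) (j := j)
  obtain ⟨p, hp⟩ := Fin.exists_succAbove_eq (Ne.symm hij : j ≠ i)
  set B : Fin N → Fin N → F := fun k' => if k' = p
      then (-(A i 0 * (A j 0)⁻¹)) • pivotReduce A i p
      else pivotReduce A i k' + (-(A (i.succAbove k') 0 * (A j 0)⁻¹)) • pivotReduce A i p with hB
  have hR : pivotReduce A j = fun k => B (τ k) := by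
    funext k l
    by_cases hk : j.succAbove k = i
    · have hτp : τ k = p := by
        apply Fin.succAbove_right_injective (p := i)
        rw [hτ, hp, hk, Equiv.swap_apply_left]
      simp only [hB, hτp, if_true, Pi.smul_apply, smul_eq_mul, pivotReduce, hp, hk]
      have : A i 0 * (A j 0)⁻¹ * (A j 0 * (A i 0)⁻¹ * A i l.succ) = A i l.succ := by
        rw [mul_assoc, mul_assoc, inv_mul_cancel_left₀ hj, mul_inv_cancel_left₀ hi]
      rw [neg_mul, mul_sub, this]
      abel
    · have hk' : i.succAbove (τ k) = j.succAbove k := by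
        rw [hτ, Equiv.swap_apply_of_ne_of_ne hk (Fin.succAbove_ne j k)]
      have hτp : τ k ≠ p := by
        intro hc
        rw [hc, hp] at hk'
        exact Fin.succAbove_ne j k hk'.symm
      simp only [hB, hτp, if_false, Pi.add_apply, Pi.smul_apply, smul_eq_mul, pivotReduce,
        hp, hk']
      have : A (j.succAbove k) 0 * (A j 0)⁻¹ * (A j 0 * (A i 0)⁻¹ * A i l.succ)
          = A (j.succAbove k) 0 * (A i 0)⁻¹ * A i l.succ := by
        simp only [mul_assoc]
        rw [inv_mul_cancel_left₀ hj]
      rw [neg_mul, mul_sub, this]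
      abel
  rw [hR, h.perm τ B, hB, h.smul_add_smul, hs, Equiv.Perm.sign_swap hij, ← mul_assoc, ← mul_assoc,
    ← modComm_mul]
  congr 1
  simp only [modComm_mul, Units.val_mul, Units.val_pow_eq_pow_val, Units.val_neg, Units.val_one,
    Int.cast_mul, Int.cast_pow, Int.cast_neg, Int.cast_one]
  rw [← neg_one_mul (A i 0 * (A j 0)⁻¹), modComm_mul, modComm_mul]
  have e1 := modComm_inv_mul hj
  have e2 := modComm_neg_one_mul_self (F := F)
  have e3 : modComm ((-1 : F) ^ (j : ℕ)) * modComm ((-1) ^ (j : ℕ)) = 1 := by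
    rw [← modComm_mul, ← pow_add, ← two_mul, pow_mul, neg_one_sq, one_pow, modComm_one]
  generalize modComm ((-1 : F) ^ (j : ℕ)) = s at *
  generalize modComm ((-1 : F) ^ (i : ℕ)) = r at *
  generalize modComm (-1 : F) = ε at *
  calc _ = (s * s) * (ε * ε) * (modComm (A j 0)⁻¹ * modComm (A j 0)) * (r * modComm (A i 0)) := by
        ac_rfl
    _ = _ := by rw [e1, e2, e3, one_mul, one_mul, one_mul]

theorem rowDet_eq_pivot {N : ℕ} (h : RowOperations F N)
    (A : Fin (N + 1) → Fin (N + 1) → F) {i : Fin (N + 1)} (hi : A i 0 ≠ 0) :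
    rowDet A = modComm ((-1) ^ (i : ℕ) * A i 0) * rowDet (pivotReduce A i) := by
  obtain ⟨j, hj, hD⟩ := exists_pivot ⟨i, hi⟩
  rw [hD, pivot_exchange h A hi hj]

/-- With the pivot free to choose, each operation either becomes row operations on the reduced
matrix or leaves it unchanged. Adding a multiple of row `j` disappears on pivoting at `j`; if `A j 0
= 0`, the first column does not change and the pivot is row `i` or a third row. -/
theorem RowOperations.succ {N : ℕ} (h : RowOperations F N) : RowOperations F (N + 1) := by
  have smul0 : ∀ (A : Fin (N + 1) → Fin (N + 1) → F) (i : Fin (N + 1)) (c : F),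
      A i 0 = 0 → rowDet (Function.update A i (c • A i)) = modComm c * rowDet A := by
    intro A i c hi
    have hcol : ∀ k, (Function.update A i (c • A i) : Fin (N + 1) → Fin (N + 1) → F) k 0 = A k 0 := by
      intro k
      by_cases hk : k = i
      · subst hk; simp [hi]
      · simp [hk]
    by_cases hz : ∀ k, A k 0 = 0
    · rw [rowDet_eq_zero_of_column hz, mul_zero]
      exact rowDet_eq_zero_of_column fun k => (hcol k).trans (hz k)
    push Not at hz
    obtain ⟨j, hj⟩ := hz
    have hij : i ≠ j := by rintro rfl; exact hj hi
    obtain ⟨p, hp⟩ := Fin.exists_succAbove_eq hij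
    rw [rowDet_eq_pivot h A hj, rowDet_eq_pivot h (i := j) _ (by rwa [hcol]), hcol,
      mul_left_comm, ← h.smul (pivotReduce A j) p c]
    congr 2
    funext k l
    by_cases hk : k = p
    · subst hk
      simp [pivotReduce, hp, hi, Ne.symm hij]
    · have hk' : j.succAbove k ≠ i := by
        rw [← hp]; exact fun hc => hk (Fin.succAbove_right_injective hc)
      simp [pivotReduce, hk, hk', Ne.symm hij]
  refine ⟨fun A i c => ?_, fun A i j c hij => ?_⟩
  · by_cases hi : A i 0 = 0
    · exact smul0 A i c hi
    by_cases hc : c = 0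
    · subst hc
      -- Row `i` is cleared beforehand: scaling this zero row by `0` shows that the determinant
      -- vanishes.
      have := smul0 (Function.update A i 0) i 0 (by simp)
      simpa [modComm_zero] using this
    · rw [rowDet_eq_pivot h A hi, rowDet_eq_pivot h (i := i) _ (by simp [hi, hc])]
      have : pivotReduce (Function.update A i (c • A i)) i = pivotReduce A i := by
        funext k l
        simp only [pivotReduce, Function.update_self, Pi.smul_apply, smul_eq_mul,
          Function.update_of_ne (Fin.succAbove_ne i k), mul_inv_rev, mul_assoc,
          inv_mul_cancel_left₀ hc]
      rw [this, Function.update_self, Pi.smul_apply, smul_eq_mul]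
      simp only [modComm_mul]
      ac_rfl
  · by_cases hj : A j 0 = 0
    · have hcol : ∀ k, (Function.update A i (A i + c • A j) : Fin (N + 1) → Fin (N + 1) → F) k 0 = A k 0 := by
        intro k
        by_cases hk : k = i
        · subst hk; simp [hj]
        · simp [hk]
      by_cases hi : A i 0 = 0
      · by_cases hz : ∀ k, A k 0 = 0
        · rw [rowDet_eq_zero_of_column hz]
          exact rowDet_eq_zero_of_column fun k => (hcol k).trans (hz k)
        push Not at hz
        obtain ⟨q, hq⟩ := hz
        have hiq : i ≠ q := by rintro rfl; exact hq hi
        have hjq : j ≠ q := by rintro rfl; exact hq hj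
        obtain ⟨p, hp⟩ := Fin.exists_succAbove_eq hiq
        obtain ⟨p', hp'⟩ := Fin.exists_succAbove_eq hjq
        have hpp : p ≠ p' := by rintro rfl; exact hij (hp.symm.trans hp')
        rw [rowDet_eq_pivot h A hq, rowDet_eq_pivot h (i := q) _ (by rwa [hcol]), hcol,
          ← h.add (pivotReduce A q) p p' c hpp]
        congr 2
        funext k l
        by_cases hk : k = p
        · subst hk
          simp [pivotReduce, hp, hp', hi, hj, Ne.symm hiq]
        · have hk' : q.succAbove k ≠ i := by
            rw [← hp]; exact fun hc => hk (Fin.succAbove_right_injective hc)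
          simp [pivotReduce, hk, hk', Ne.symm hiq]
      · obtain ⟨p, hp⟩ := Fin.exists_succAbove_eq hij.symm
        rw [rowDet_eq_pivot h A hi, rowDet_eq_pivot h (i := i) _ (by rwa [hcol]), hcol,
          ← h.add_smul (pivotReduce A i) p
            (fun k => -(A (i.succAbove k) 0 * (A i 0)⁻¹ * c)) (by simp [hp, hj])]
        congr 2
        funext k l
        simp [pivotReduce, hp, hj, mul_add, mul_assoc]
        abel
    · rw [rowDet_eq_pivot h A hj, rowDet_eq_pivot h (i := j) _ (by simp [hij.symm, hj])]
      have : pivotReduce (Function.update A i (A i + c • A j)) j = pivotReduce A j := by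
        funext k l
        by_cases hk : j.succAbove k = i
        · simp [pivotReduce, hk, hij.symm, add_mul, mul_assoc, hj]
        · simp [pivotReduce, hk, hij.symm]
      rw [this, Function.update_of_ne hij.symm]

theorem rowOperations (F : Type u) [DivisionRing F] (N : ℕ) : RowOperations F N := by
  induction N with
  | zero => exact ⟨fun _ i => i.elim0, fun _ i => i.elim0⟩
  | succ N ih => exact ih.succ

end DieudonneDet

/-! ### Cofactors and the Leibniz expansion modulo commutators. -/

section Expansion

variable {F : Type u} [DivisionRing F]

theorem rowDet_update_sum {N : ℕ} (A : Fin N → Fin N → F) (i : Fin N) (c : Fin N → F) :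
    rowDet (Function.update A i (∑ k, c k • A k)) = modComm (c i) * rowDet A := by
  have key : ∀ s : Finset (Fin N), i ∉ s →
      rowDet (Function.update A i (c i • A i + ∑ k ∈ s, c k • A k))
        = modComm (c i) * rowDet A := by
    intro s
    induction s using Finset.induction_on with
    | empty => simp [(rowOperations F N).smul]
    | insert a s ha ih =>
      intro hi
      rw [Finset.mem_insert, not_or] at hi
      rw [← ih hi.2, ← (rowOperations F N).add
        (Function.update A i (c i • A i + ∑ k ∈ s, c k • A k)) i a (c a) hi.1]
      congr 1
      rw [Function.update_idem, Function.update_self, Function.update_of_ne (Ne.symm hi.1),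
        Finset.sum_insert ha]
      congr 1
      abel
  rw [← key (Finset.univ.erase i) (by simp),
    Finset.add_sum_erase _ (fun k => c k • A k) (Finset.mem_univ i)]

/-- Pivoting on the entry `1` leaves the other rows untouched. This identifies the coefficients of
the linear form below as signed minors. -/
theorem rowDet_cons_single {N : ℕ} (B : Fin (N + 1) → Fin N → F) (i : Fin (N + 1)) :
    rowDet (fun k => (Fin.cons ((Pi.single i 1 : Fin (N + 1) → F) k) (B k) : Fin (N + 1) → F))
      = modComm ((-1) ^ (i : ℕ)) * rowDet (fun k => B (i.succAbove k)) := by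
  rw [rowDet_eq_pivot (rowOperations F N) (i := i) _ (by simp)]
  congr 2
  · simp
  · funext k l
    simp [pivotReduce]

/-- The Dieudonné determinant, as a function of the first column, is the class of a linear form
that vanishes on the other columns. -/
theorem exists_linear_form_rowDet {N : ℕ} (B : Fin (N + 1) → Fin N → F) :
    ∃ v : Fin (N + 1) → F, (∀ l, ∑ i, v i * B i l = 0) ∧
      ∀ s : Fin (N + 1) → F, modComm (∑ i, v i * s i)
        = rowDet (fun i => (Fin.cons (s i) (B i) : Fin (N + 1) → F)) := by
  have hdep : ¬ LinearIndependent F B := fun h => by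
    have := h.fintype_card_le_finrank
    simp at this
  obtain ⟨c, hc, i, hi⟩ := Fintype.not_linearIndependent_iff.mp hdep
  obtain ⟨z, hz⟩ := modComm_surjective (rowDet fun k => B (i.succAbove k))
  have hcl : ∀ l, ∑ k, c k * B k l = 0 := fun l => by
    have := congrFun hc l
    simpa using this
  -- The relation `c` is normalized so that its `i`-th coefficient becomes `(-1)^i z`, a
  -- representative of the signed minor.
  refine ⟨fun k => (c i)⁻¹ * (-1) ^ (i : ℕ) * z * c k, fun l => ?_, fun s => ?_⟩
  · simp only [mul_assoc, ← Finset.mul_sum, hcl, mul_zero]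
  set A : Fin (N + 1) → Fin (N + 1) → F := fun k => Fin.cons (s k) (B k) with hA
  -- Replacing row `i` by `∑ c k • A k` multiplies the determinant by the class of `c i` and leaves
  -- only the first entry of that row, so the determinant can be read off.
  have h1 := rowDet_update_sum A i c
  have hrow : ∑ k, c k • A k = Fin.cons (∑ k, c k * s k) 0 := by
    funext l
    refine Fin.cases ?_ (fun l => ?_) l
    · simp [hA]
    · simpa [hA] using hcl l
  have h2 : rowDet (Function.update A i (∑ k, c k • A k))
      = modComm ((-1) ^ (i : ℕ) * ∑ k, c k * s k) * modComm z := by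
    by_cases ht : ∑ k, c k * s k = 0
    · rw [ht, mul_zero, modComm_zero, zero_mul]
      apply (rowOperations F (N + 1)).eq_zero (i := i)
      rw [Function.update_self, hrow, ht]
      funext l
      refine Fin.cases ?_ (fun l => ?_) l <;> simp
    · rw [rowDet_eq_pivot (rowOperations F N) (i := i) _ (by simpa [hrow] using ht), hz]
      congr 2
      · simp [hrow]
      · funext k l
        simp [pivotReduce, hA, hcl]
  rw [h1] at h2
  simp only [mul_assoc, ← Finset.mul_sum]
  have h3 := modComm_inv_mul hi
  rw [modComm_mul, modComm_mul, modComm_mul z]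
  rw [modComm_mul] at h2
  calc _ = modComm (c i)⁻¹ * (modComm ((-1) ^ (i : ℕ)) * modComm (∑ k, c k * s k) * modComm z) := by
        ac_rfl
    _ = rowDet A := by rw [← h2, ← mul_assoc, h3, one_mul]

/-- Every representative of the Dieudonné determinant is a signed sum of representatives of the
products that occur in the Leibniz formula. -/
theorem exists_leibniz_expansion (N : ℕ) :
    ∃ (κ : Type) (_ : Fintype κ) (n : κ → ℤ) (ρ : κ → Fin N → Fin N), Function.Injective ρ ∧
      ∀ (F : Type u) [DivisionRing F] (A : Fin N → Fin N → F) (c : F), modComm c = rowDet A →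
        ∃ w : κ → F, (∀ k, modComm (w k) = ∏ j, modComm (A (ρ k j) j)) ∧
          c = ∑ k, (n k : F) * w k := by
  induction N with
  | zero =>
    refine ⟨Unit, inferInstance, fun _ => 1, fun _ => id, fun _ _ _ => rfl,
      fun F _ A c hc => ⟨fun _ => c, fun _ => ?_, by simp⟩⟩
    rw [hc, rowDet, dieudonneDet]
    simp
  | succ N ih =>
    obtain ⟨κ, _, n, ρ, hρ, ih⟩ := ih
    refine ⟨Fin (N + 1) × κ, inferInstance, fun x => (-1) ^ (x.1 : ℕ) * n x.2,
      fun x => Fin.cons x.1 (fun j => x.1.succAbove (ρ x.2 j)), ?_, ?_⟩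
    · rintro ⟨i, k⟩ ⟨i', k'⟩ h
      obtain ⟨h1, h2⟩ := Fin.cons_injective2 h
      dsimp only at h1 h2
      subst h1
      have : k = k' := hρ (funext fun j => Fin.succAbove_right_injective (congrFun h2 j))
      rw [this]
    intro F _ A c hc
    obtain ⟨v, -, hv⟩ := exists_linear_form_rowDet (fun i l => A i l.succ)
    have hcons : (fun i => (Fin.cons (A i 0) (fun l => A i l.succ) : Fin (N + 1) → F)) = A :=
      funext fun i => Fin.cons_self_tail (A i)
    have hc' := hv fun i => A i 0
    rw [hcons, ← hc] at hc'
    -- The factor `t` of class `1` makes the first-column expansion an equality in `F` for the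
    -- prescribed `c`.
    obtain ⟨t, ht, ht1⟩ := exists_one_mul_of_modComm_eq hc'.symm
    have hterm : ∀ i, ∃ w : κ → F,
        (∀ k, modComm (w k)
          = modComm (A i 0) * ∏ j : Fin N, modComm (A (i.succAbove (ρ k j)) j.succ)) ∧
        t * (v i * A i 0) = ∑ k, (((-1) ^ (i : ℕ) * n k : ℤ) : F) * w k := by
      intro i
      obtain ⟨y, hy⟩ := modComm_surjective (rowDet fun k l => A (i.succAbove k) l.succ)
      obtain ⟨w, hw, hyw⟩ := ih F _ y hy
      have hvi : modComm (v i) = modComm ((-1) ^ (i : ℕ)) * modComm y := by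
        rw [hy, ← rowDet_cons_single (fun k l => A k l.succ) i, ← hv]
        simp [Pi.single_apply]
      have hsq : ((-1 : F) ^ (i : ℕ)) * (-1) ^ (i : ℕ) = 1 := by
        rw [← pow_add, ← two_mul, pow_mul, neg_one_sq, one_pow]
      -- Each signed term becomes `b * y`, with `b` in the class of `A i 0` and `y` representing the
      -- minor. The expansion of `y` can then be multiplied by `b`, since integers are central.
      obtain ⟨b, hb, hb1⟩ := exists_mul_of_modComm_eq (a := (-1) ^ (i : ℕ) * (t * (v i * A i 0)))
          (b := A i 0) (c := y) (by
        have hsq' := congrArg modComm hsq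
        rw [modComm_mul, modComm_one] at hsq'
        rw [modComm_mul, modComm_mul t, ht1, one_mul, modComm_mul (v i), hvi, ← mul_assoc,
          ← mul_assoc, hsq', one_mul, mul_comm])
      refine ⟨fun k => b * w k, fun k => by rw [modComm_mul, hb1, hw], ?_⟩
      have h2 : t * (v i * A i 0) = (-1) ^ (i : ℕ) * (b * y) := by
        rw [← hb, ← mul_assoc ((-1) ^ (i : ℕ)), hsq, one_mul]
      rw [h2, hyw, Finset.mul_sum, Finset.mul_sum]
      refine Finset.sum_congr rfl fun k _ => ?_
      push_cast
      rw [← mul_assoc b, (Int.cast_commute (n k) b).eq.symm]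
      simp only [mul_assoc]
    choose w hw hwt using hterm
    refine ⟨fun x => w x.1 x.2, fun x => ?_, ?_⟩
    · rw [hw, Fin.prod_univ_succ]
      simp
    · rw [ht, Finset.mul_sum, Fintype.sum_prod_type]
      exact Finset.sum_congr rfl fun i _ => hwt i

/-- Injectivity of `α` matters: a value uses one representative per monomial, and `n₁ w₁ + n₂ w₂`
with `w₁`, `w₂` in one class need not be `n₁ + n₂` times a member of that class. -/
theorem isValueModComm_sum_monomial {ι κ : Type} [Fintype κ] {α : κ → ι →₀ ℕ}
    (hα : Function.Injective α) (n : κ → ℤ) (v : ι → F) (w : κ → F)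
    (hw : ∀ k, modComm (w k) = (α k).prod fun i e => modComm (v i) ^ e) :
    IsValueModComm (∑ k, MvPolynomial.monomial (α k) (n k)) v (∑ k, (n k : F) * w k) := by
  classical
  have hcoeff : ∀ k, (∑ k, MvPolynomial.monomial (α k) (n k)).coeff (α k) = n k := fun k => by
    simp [MvPolynomial.coeff_sum, MvPolynomial.coeff_monomial, hα.eq_iff]
  have hsupp : (∑ k, MvPolynomial.monomial (α k) (n k)).support ⊆ Finset.univ.image α := by
    intro a ha
    by_contra hc
    rw [MvPolynomial.mem_support_iff, MvPolynomial.coeff_sum] at ha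
    refine ha (Finset.sum_eq_zero fun k _ => ?_)
    rw [MvPolynomial.coeff_monomial, if_neg]
    rintro rfl
    exact hc (Finset.mem_image_of_mem α (Finset.mem_univ k))
  refine ⟨Function.extend α w 0, fun a ha => ?_, ?_⟩
  · obtain ⟨k, -, rfl⟩ := Finset.mem_image.mp (hsupp ha)
    rw [hα.extend_apply, hw]
  · rw [Finset.sum_subset hsupp, Finset.sum_image fun _ _ _ _ h => hα h]
    · exact Finset.sum_congr rfl fun k _ => by rw [hcoeff, hα.extend_apply]
    · intro a _ ha
      rw [MvPolynomial.notMem_support_iff.mp ha, Int.cast_zero, zero_mul]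

theorem isValueModComm_zero {ι : Type} (v : ι → F) : IsValueModComm 0 v (0 : F) :=
  ⟨0, by simp, by simp⟩

/-- The first row of the adjugate, modulo commutators: there is a row vector that is orthogonal
to all columns but the first, whose product with the first column represents the Dieudonné
determinant, and whose entries are values of integer polynomials at the entries of the matrix. -/
theorem exists_adjugate_row (N : ℕ) (hN : 0 < N) :
    ∃ P : Fin N → MvPolynomial (Fin N × Fin N) ℤ,
      ∀ (F : Type u) [DivisionRing F] (A : Matrix (Fin N) (Fin N) F),
        ∃ v : Fin N → F, (∀ j : Fin N, (j : ℕ) ≠ 0 → ∑ i, v i * A i j = 0) ∧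
          modComm (∑ i, v i * A i ⟨0, hN⟩) = dieudonneDet A ∧
          ∀ i, IsValueModComm (P i) (fun e => A e.1 e.2) (v i) := by
  obtain ⟨N, rfl⟩ : ∃ M, N = M + 1 := ⟨N - 1, by omega⟩
  obtain ⟨κ, _, n, ρ, hρ, hexp⟩ := exists_leibniz_expansion.{u} N
  -- Exponents of the Leibniz products of the minor without row `i` and the first column, in the
  -- variables of the full matrix.
  set α : Fin (N + 1) → κ → (Fin (N + 1) × Fin (N + 1)) →₀ ℕ := fun i k =>
    ∑ j : Fin N, Finsupp.single (i.succAbove (ρ k j), j.succ) 1 with hα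
  have hαapp : ∀ i k a (j : Fin N), α i k (a, j.succ) = if i.succAbove (ρ k j) = a then 1 else 0 := by
    intro i k a j
    rw [hα, Finsupp.finsetSum_apply, Finset.sum_eq_single j]
    · simp [Finsupp.single_apply]
    · intro b _ hb
      simp [hb]
    · simp
  have hαinj : ∀ i, Function.Injective (α i) := by
    intro i k k' h
    refine hρ (funext fun j => ?_)
    have := DFunLike.congr_fun h (i.succAbove (ρ k j), j.succ)
    rw [hαapp, hαapp, if_pos rfl] at this
    by_contra hc
    rw [if_neg fun h' => hc (Fin.succAbove_right_injective h').symm] at this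
    exact one_ne_zero this
  refine ⟨fun i => ∑ k, MvPolynomial.monomial (α i k) ((-1) ^ (i : ℕ) * n k), fun F _ A => ?_⟩
  obtain ⟨v, hv0, hv⟩ := exists_linear_form_rowDet (fun i (l : Fin N) => A i l.succ)
  refine ⟨v, fun j hj => ?_, ?_, fun i => ?_⟩
  · obtain ⟨l, rfl⟩ := Fin.exists_succ_eq.mpr (fun h : j = 0 => hj (by simp [h]))
    exact hv0 l
  · have := hv fun i => A i 0
    refine this.trans ?_
    rw [rowDet]
    congr 1
    funext i
    exact Fin.cons_self_tail (A i)
  · have hsq : ((-1 : F) ^ (i : ℕ)) * (-1) ^ (i : ℕ) = 1 := by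
      rw [← pow_add, ← two_mul, pow_mul, neg_one_sq, one_pow]
    have hvi : modComm ((-1) ^ (i : ℕ) * v i)
        = rowDet (fun k l => A (i.succAbove k) l.succ) := by
      have h1 := hv (Pi.single i 1)
      rw [rowDet_cons_single] at h1
      have h2 : ∑ k, v k * (Pi.single i 1 : Fin (N + 1) → F) k = v i := by
        simp [Pi.single_apply]
      rw [modComm_mul, ← h2, h1, ← mul_assoc, ← modComm_mul, hsq, modComm_one, one_mul]
    obtain ⟨w, hw, hvw⟩ := hexp F _ _ hvi
    have hvi' : v i = ∑ k, (((-1) ^ (i : ℕ) * n k : ℤ) : F) * w k := by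
      rw [← one_mul (v i), ← hsq, mul_assoc, hvw, Finset.mul_sum]
      push_cast
      simp only [mul_assoc]
    rw [hvi']
    refine isValueModComm_sum_monomial (hαinj i) _ _ w fun k => ?_
    rw [hw, hα, ← Finsupp.prod_finsetSum_index (by simp) (by intros; rw [pow_add])]
    refine Finset.prod_congr rfl fun j _ => ?_
    rw [Finsupp.prod_single_index (by simp), pow_one]

end Expansion

/-! ### Sylvester rows as coefficients in the Ore extension. -/

namespace OreExt

section Coefficients

variable {F : Type u} [Ring F] {σ : F →+* F} {δ : SkewDerivation σ}

/-- The coefficient of `xⁱ` as an additive map. -/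
def coeffHom (i : ℕ) : OreExt σ δ →+ F := show (ℕ →₀ F) →+ F from Finsupp.applyAddHom i

theorem ext_coeff {f g : OreExt σ δ} (h : ∀ i, f.coeff i = g.coeff i) : f = g :=
  Finsupp.ext h

theorem coeff_monomial (i j : ℕ) (a : F) :
    (monomial i a : OreExt σ δ).coeff j = if i = j then a else 0 :=
  Finsupp.single_apply

theorem coeff_smul (a : F) (f : OreExt σ δ) (i : ℕ) : (a • f).coeff i = a * f.coeff i := rfl

theorem coeff_add (f g : OreExt σ δ) (i : ℕ) : (f + g).coeff i = f.coeff i + g.coeff i := rfl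

theorem coeff_sum {ι : Type*} (s : Finset ι) (f : ι → OreExt σ δ) (i : ℕ) :
    (∑ k ∈ s, f k).coeff i = ∑ k ∈ s, (f k).coeff i :=
  map_sum (coeffHom (σ := σ) (δ := δ) i) f s

theorem coeff_eq_zero_of_natDegree_lt {f : OreExt σ δ} {i : ℕ} (h : f.natDegree < i) :
    f.coeff i = 0 := by
  by_contra hc
  have hi : i ∈ (show ℕ →₀ F from f).support := Finsupp.mem_support_iff.mpr hc
  exact absurd (Finset.le_sup (f := id) hi) (not_le.mpr h)

theorem coeff_xMul_zero (f : OreExt σ δ) : (xMul f).coeff 0 = δ.toFun (f.coeff 0) := by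
  have : (coeffHom 0).comp xMul = δ.toAddMonoidHom.comp (coeffHom (σ := σ) (δ := δ) 0) := by
    refine hom_ext fun i a => ?_
    change (xMul (monomial i a)).coeff 0 = δ.toAddMonoidHom ((monomial i a : OreExt σ δ).coeff 0)
    rw [xMul_monomial, coeff_add, coeff_monomial, coeff_monomial, coeff_monomial,
      if_neg (Nat.succ_ne_zero i), zero_add, apply_ite δ.toAddMonoidHom, map_zero]
    rfl
  exact DFunLike.congr_fun this f

theorem coeff_xMul_succ (f : OreExt σ δ) (q : ℕ) :
    (xMul f).coeff (q + 1) = δ.toFun (f.coeff (q + 1)) + σ (f.coeff q) := by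
  have : (coeffHom (q + 1)).comp xMul = δ.toAddMonoidHom.comp
      (coeffHom (σ := σ) (δ := δ) (q + 1)) + σ.toAddMonoidHom.comp (coeffHom q) := by
    refine hom_ext fun i a => ?_
    change (xMul (monomial i a)).coeff (q + 1) = δ.toAddMonoidHom ((monomial i a : OreExt σ δ).coeff (q + 1))
      + σ ((monomial i a : OreExt σ δ).coeff q)
    rw [xMul_monomial, coeff_add]
    simp only [coeff_monomial, add_left_inj]
    rw [apply_ite δ.toAddMonoidHom, map_zero, apply_ite σ, map_zero, add_comm]
    rfl
  exact DFunLike.congr_fun this f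

theorem skewComp_zero : ∀ d s : ℕ, skewComp σ δ d s 0 = 0
  | 0, 0 => by rw [skewComp]
  | d + 1, 0 => by
    rw [skewComp, skewComp_zero d 0]
    exact map_zero δ.toAddMonoidHom
  | 0, s + 1 => by rw [skewComp, skewComp_zero 0 s, map_zero]
  | d + 1, s + 1 => by
    rw [skewComp, skewComp_zero d (s + 1), skewComp_zero (d + 1) s, map_zero, add_zero]
    exact map_zero δ.toAddMonoidHom

/-- The range of summation no longer depends on `p`, which prepares the induction on `p`. -/
theorem sylvesterEntry_eq_sum (f : OreExt σ δ) (p q : ℕ) :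
    sylvesterEntry f p q = ∑ l ∈ Finset.range (q + 1),
      if l ≤ p then skewComp σ δ (p - l) l (f.coeff (q - l)) else 0 := by
  rw [sylvesterEntry, ← Finset.sum_filter]
  refine Finset.sum_congr ?_ fun _ _ => rfl
  ext l
  simp only [Finset.mem_filter, Finset.mem_range]
  omega

/-- The coefficient rule for multiplication by `x`, namely `δ` of the same coefficient plus `σ` of
the previous one, matches the splitting of compositions by their outermost map. -/
theorem coeff_xMul_pow (f : OreExt σ δ) (p q : ℕ) :
    ((xMul ^ p) f).coeff q = sylvesterEntry f p q := by
  induction p generalizing q with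
  | zero =>
    rw [sylvesterEntry_eq_sum, Finset.sum_eq_single 0]
    · simp [skewComp]
    · intro l _ hl
      rw [if_neg (by omega)]
    · simp
  | succ p ih =>
    rw [pow_succ']
    change (xMul ((xMul ^ p) f)).coeff q = _
    have hδ0 : δ.toFun 0 = 0 := map_zero δ.toAddMonoidHom
    have hzero : ∀ a, skewComp σ δ (p + 1) 0 a = δ.toFun (skewComp σ δ p 0 a) := fun a => by
      rw [skewComp]
    cases q with
    | zero =>
      rw [coeff_xMul_zero, ih, sylvesterEntry_eq_sum, sylvesterEntry_eq_sum]
      simp [hzero]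
    | succ q =>
      rw [coeff_xMul_succ, ih, ih, sylvesterEntry_eq_sum, sylvesterEntry_eq_sum,
        sylvesterEntry_eq_sum, Finset.sum_range_succ' _ (q + 1), Finset.sum_range_succ' _ (q + 1)]
      change δ.toAddMonoidHom _ + _ = _
      rw [map_add, map_sum, map_sum, add_right_comm, ← Finset.sum_add_distrib]
      congr 1
      · refine Finset.sum_congr rfl fun l _ => ?_
        rw [Nat.add_sub_add_right, Nat.add_sub_add_right]
        change δ.toFun _ + _ = _
        -- For `l < p` both outermost maps occur; for `l = p` only `σ` remains; for `l > p` all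
        -- terms vanish.
        rcases lt_trichotomy l p with h | rfl | h
        · obtain ⟨d, rfl⟩ : ∃ d, p = l + d + 1 := ⟨p - l - 1, by omega⟩
          rw [if_pos (by omega), if_pos (by omega), if_pos (by omega),
            show l + d + 1 - (l + 1) = d by omega, show l + d + 1 - l = d + 1 by omega]
          simp only [skewComp]
        · rw [if_neg (by omega), if_pos le_rfl, if_pos le_rfl, hδ0, zero_add, Nat.sub_self]
          simp only [skewComp]
        · rw [if_neg (by omega), if_neg (by omega), if_neg (by omega), hδ0, map_zero, zero_add]
      · simp only [Nat.zero_le, if_true, Nat.sub_zero, hzero]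
        rfl

theorem coeff_monomial_mul (f : OreExt σ δ) (p q : ℕ) (a : F) :
    (monomial p a * f).coeff q = a * sylvesterEntry f p q := by
  rw [mul_def, leftMul_monomial, ← coeff_xMul_pow, ← coeff_smul]
  rfl

theorem sylvesterEntry_eq_zero {f : OreExt σ δ} {p q : ℕ} (h : p + f.natDegree < q) :
    sylvesterEntry f p q = 0 := by
  refine Finset.sum_eq_zero fun l hl => ?_
  rw [Finset.mem_filter, Finset.mem_range] at hl
  rw [coeff_eq_zero_of_natDegree_lt (by omega), skewComp_zero]

end Coefficients

end OreExt

/-! ### Reading the cofactor row as a pair of polynomials. -/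

theorem proposition3p13 (m n : ℕ) (hm : 0 < m) (hn : 0 < n) :
    ∃ P Q : ℕ → MvPolynomial (Fin (n + m) × Fin (n + m)) ℤ,
      ∀ (F : Type u) [DivisionRing F] (σ : F →+* F) (δ : SkewDerivation σ) (f g : OreExt σ δ),
        f.natDegree = m → g.natDegree = n →
          ∃ (A B : OreExt σ δ) (r : F),
            modComm r = skewResultant f g ∧
            A * f + B * g = OreExt.C r ∧
            ∀ i : ℕ,
              IsValueModComm (P i) (fun e => sylvesterMatrix m n f g e.1 e.2) (A.coeff i) ∧
              IsValueModComm (Q i) (fun e => sylvesterMatrix m n f g e.1 e.2) (B.coeff i) := by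
  obtain ⟨P, hP⟩ := exists_adjugate_row.{u} (n + m) (by omega)
  refine ⟨fun k => if h : k < n then P (Fin.castAdd m ⟨k, h⟩) else 0,
    fun k => if h : k < m then P (Fin.natAdd n ⟨k, h⟩) else 0, ?_⟩
  intro F _ σ δ f g hf hg
  obtain ⟨v, hv0, hv, hval⟩ := hP F (sylvesterMatrix m n f g)
  have hcoeff : ∀ (N : ℕ) (a : Fin N → F) (k : ℕ),
      (∑ i : Fin N, OreExt.monomial (i : ℕ) (a i) : OreExt σ δ).coeff k
        = if h : k < N then a ⟨k, h⟩ else 0 := by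
    intro N a k
    simp only [OreExt.coeff_sum, OreExt.coeff_monomial]
    split_ifs with h
    · rw [Finset.sum_eq_single ⟨k, h⟩]
      · simp
      · intro i _ hi
        exact if_neg fun hc => hi (Fin.ext hc)
      · simp
    · exact Finset.sum_eq_zero fun i _ => if_neg fun hc => h (by omega)
  -- The first `n` entries of `v` are the coefficients of `A`, the last `m` those of `B`; `r` is the
  -- product of `v` with the first column.
  refine ⟨∑ i : Fin n, OreExt.monomial (i : ℕ) (v (Fin.castAdd m i)),
    ∑ i : Fin m, OreExt.monomial (i : ℕ) (v (Fin.natAdd n i)), _,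
    hv.trans (by rw [skewResultant, hf, hg]), OreExt.ext_coeff fun q => ?_, fun k => ⟨?_, ?_⟩⟩
  · rw [OreExt.C, OreExt.coeff_monomial, OreExt.coeff_add, Finset.sum_mul, Finset.sum_mul,
      OreExt.coeff_sum, OreExt.coeff_sum]
    simp only [OreExt.coeff_monomial_mul]
    by_cases hq : q < n + m
    · have hsum : ∑ i, v i * sylvesterMatrix m n f g i ⟨q, hq⟩
          = ∑ i : Fin n, v (Fin.castAdd m i) * sylvesterEntry f i q
            + ∑ i : Fin m, v (Fin.natAdd n i) * sylvesterEntry g i q := by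
        rw [Fin.sum_univ_add]
        simp [sylvesterMatrix]
      rw [← hsum]
      split_ifs with h
      · subst h
        rfl
      · exact hv0 _ (Ne.symm h)
    -- Both products have degree at most `n + m - 1`, so the columns of the matrix account for all
    -- coefficients.
    · rw [if_neg (by omega), Finset.sum_eq_zero, Finset.sum_eq_zero, add_zero]
      · intro i _
        rw [OreExt.sylvesterEntry_eq_zero (by omega), mul_zero]
      · intro i _
        rw [OreExt.sylvesterEntry_eq_zero (by omega), mul_zero]
  · rw [hcoeff]
    dsimp only
    split_ifs with h
    · exact hval _
    · exact isValueModComm_zero _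
  · rw [hcoeff]
    dsimp only
    split_ifs with h
    · exact hval _
    · exact isValueModComm_zero _
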